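/- \textbf{Setting.} Let $\mathbb N=\{1,2,\dots\}$ and $\mathbb Z_-=\{\dots,-1,0\}$, let $\sigma(x)=\max\{x,0\}$, applied entrywise to vectors, and let $d\in\mathbb N$. An operator $F:([-1,1]^d)^{\mathbb Z}\to\mathbb R^{\mathbb Z}$ is called \emph{causal} if $F(u)_t=F(v)_t$ whenever $u_j=v_j$ for all $j\le t$; \emph{time-invariant} if $F(T_\tau u)_t=F(u)_{t-\tau}$ for all $\tau,t\in\mathbb Z$ and all $u$, where $(T_\tau u)_t=u_{t-\tau}$; and \emph{continuous} if it takes values in $[-B,B]^{\mathbb Z}$ for some $B>0$ and is continuous for the product topologies. For $W_1\in\mathbb R^{n\times n}$, $W_2\in\mathbb R^{n\times d}$ and $b\in\mathbb R^n$, the system $s_t=\sigma(W_1s_{t-1}+W_2u_t+b)$ has the \emph{existence of solutions property} if for every $u\in([-1,1]^d)^{\mathbb Z_-}$ there is $s\in(\mathbb R^n)^{\mathbb Z_-}$ that satisfies this equation for every $t\in\mathbb Z_-$. Given a readout vector $a\in\mathbb R^n$ and a choice $u\mapsto s(u)$ of one such solution for every $u\in([-1,1]^d)^{\mathbb Z_-}$,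 the corresponding operator $F_{ESN}:([-1,1]^d)^{\mathbb Z}\to\mathbb R^{\mathbb Z}$ is $F_{ESN}(u)_t=a\cdot s(u_{-\infty:t})_0$, where $u_{-\infty:t}\in([-1,1]^d)^{\mathbb Z_-}$ is the sequence $j\mapsto u_{t+j}$. For $m\in\mathbb N$ let $P\in\mathbb R^{md\times md}$ be the block matrix with identity blocks $I_d$ directly above the block diagonal and zero blocks elsewhere, and let $Q\in\mathbb R^{md\times d}$ be the block column whose last block is $I_d$ and whose other blocks are zero. \textbf{Statement.} Let $\mu$ be a symmetric probability distribution on $\mathbb R$ whose support contains $[-r,r]$ for some $r>0$ and with $\int x^2\,d\mu(x)=M_2<\infty$. Then for every continuous causal time-invariant operator $F:([-1,1]^d)^{\mathbb Z}\to\mathbb R^{\mathbb Z}$ and all $\epsilon,\delta\in(0,1)$ there exist $n,m\in\mathbb N$ such that the following holds. Let $(w_1^\intercal,b_1),\dots,(w_n^\intercal,b_n)$ be i.i.d. samples from $\mu^{md+1}$, and put $W=(w_1,\dots,w_n)^\intercal\in\mathbb R^{n\times md}$ and $b=(b_1,\dots,b_n)^\intercal$. With probability at least $1-\delta$ (that is,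 on a measurable event of at least this probability), the ReLU echo state network $$ s_t=\sigma\Big(W\big(\tfrac{2}{nM_2}PW^\intercal s_{t-1}+Qu_t\big)+b\Big),\qquad y_t=a\cdot s_t, $$ has the existence of solutions property, and there exist $a\in\mathbb R^n$ and a choice of solutions for which the corresponding operator $F_{ESN}$ satisfies $$ \sup_{u\in([-1,1]^d)^{\mathbb Z}}\|F(u)-F_{ESN}(u)\|_\infty\le\epsilon. $$ -/

import Mathlib

open MeasureTheory Matrix

noncomputable section

namespace EchoState

/-- The cube `[-1,1]^d` of admissible input vectors. -/
abbrev Cube (d : ℕ) : Type := Fin d → Set.Icc (-1 : ℝ) 1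

/-- The index set `ℤ₋ = {…, -2, -1, 0}` of left-infinite sequences. -/
abbrev NonposInt : Type := Set.Iic (0 : ℤ)

/-- Time `0`, the last index of a left-infinite sequence. -/
def NonposInt.last : NonposInt := ⟨0, Set.mem_Iic.2 le_rfl⟩

/-- The index `t - 1` preceding `t` in `ℤ₋`. -/
def NonposInt.pred (t : NonposInt) : NonposInt :=
  ⟨(t : ℤ) - 1, Set.mem_Iic.2 (by have := Set.mem_Iic.1 t.2; omega)⟩

/-- The time delay operator, `T_τ(u)_t = u_{t-τ}`. -/
def timeDelay {α : Type*} (τ : ℤ) (u : ℤ → α) : ℤ → α := fun t => u (t - τ)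

/-- The natural projection of two-sided sequences onto left-infinite ones. -/
def restrictNonpos {α : Type*} (u : ℤ → α) : NonposInt → α := fun t => u t

/-- The history `u_{-∞:t}` up to time `t`, seen as a left-infinite sequence whose entry at time
`0` is `u_t`. -/
def history {α : Type*} (u : ℤ → α) (t : ℤ) : NonposInt → α := restrictNonpos (timeDelay (-t) u)

/-- `F(u)_t` depends only on the entries of `u` up to time `t`. -/
def IsCausal {d : ℕ} (F : (ℤ → Cube d) → (ℤ → ℝ)) : Prop :=
  ∀ (u v : ℤ → Cube d) (t : ℤ), (∀ j : ℤ, j ≤ t → u j = v j) → F u t = F v t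

/-- `F(T_τ(u))_t = F(u)_{t-τ}` for every delay `τ`. -/
def IsTimeInvariant {d : ℕ} (F : (ℤ → Cube d) → (ℤ → ℝ)) : Prop :=
  ∀ (τ : ℤ) (u : ℤ → Cube d) (t : ℤ), F (timeDelay τ u) t = F u (t - τ)

/-- Continuous causal time-invariant operators; the sequence spaces carry the product topology. -/
structure IsContinuousCausalTimeInvariant {d : ℕ} (F : (ℤ → Cube d) → (ℤ → ℝ)) : Prop where
  causal : IsCausal F
  timeInvariant : IsTimeInvariant F
  bounded : ∃ B : ℝ, 0 < B ∧ ∀ (u : ℤ → Cube d) (t : ℤ), |F u t| ≤ B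
  continuous : Continuous F

/-- The ReLU function. -/
def relu (x : ℝ) : ℝ := max x 0

/-- `s` solves `s_t = φ(W₁ s_{t-1} + W₂ u_t + b)`, `t ∈ ℤ₋`, for the left-infinite input `u`
(with `φ` applied entrywise). -/
def IsSolution {n d : ℕ} (φ : ℝ → ℝ) (W₁ : Matrix (Fin n) (Fin n) ℝ)
    (W₂ : Matrix (Fin n) (Fin d) ℝ) (b : Fin n → ℝ)
    (u : NonposInt → Cube d) (s : NonposInt → Fin n → ℝ) : Prop :=
  ∀ (t : NonposInt) (i : Fin n),
    s t i = φ ((W₁ *ᵥ s t.pred + W₂ *ᵥ (fun k => (u t k : ℝ)) + b) i)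

/-- Existence of solutions property: every left-infinite input in the cube admits a solution. -/
def HasSolutions {n d : ℕ} (φ : ℝ → ℝ) (W₁ : Matrix (Fin n) (Fin n) ℝ)
    (W₂ : Matrix (Fin n) (Fin d) ℝ) (b : Fin n → ℝ) : Prop :=
  ∀ u : NonposInt → Cube d, ∃ s : NonposInt → Fin n → ℝ, IsSolution φ W₁ W₂ b u s

/-- `H` is an operator assigned to the echo state network with readout `a`: for some choice
`u ↦ s(u)` of a solution for every left-infinite input, `H(u)_t = a · s(u_{-∞:t})_0`. -/
def IsESNOperator {n d : ℕ} (φ : ℝ → ℝ) (W₁ : Matrix (Fin n) (Fin n) ℝ)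
    (W₂ : Matrix (Fin n) (Fin d) ℝ) (b a : Fin n → ℝ)
    (H : (ℤ → Cube d) → (ℤ → ℝ)) : Prop :=
  ∃ s : (NonposInt → Cube d) → (NonposInt → Fin n → ℝ),
    (∀ u : NonposInt → Cube d, IsSolution φ W₁ W₂ b u (s u)) ∧
    ∀ (u : ℤ → Cube d) (t : ℤ), H u t = a ⬝ᵥ s (history u t) NonposInt.last

/-- The `md × md` block matrix with `I_d` in the blocks just above the diagonal, `0` elsewhere.
The coordinate `k` of block `i` has index `(i, k)`. -/
def shiftMatrix (m d : ℕ) : Matrix (Fin m × Fin d) (Fin m × Fin d) ℝ :=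
  Matrix.of fun p q => if (q.1 : ℕ) = (p.1 : ℕ) + 1 ∧ p.2 = q.2 then 1 else 0

/-- The `md × d` block matrix whose last block is `I_d` and whose other blocks are `0`. -/
def inputMatrix (m d : ℕ) : Matrix (Fin m × Fin d) (Fin d) ℝ :=
  Matrix.of fun p k => if (p.1 : ℕ) + 1 = m ∧ p.2 = k then 1 else 0

/-- A family of `n` weight samples `(w_i, b_i) ∈ ℝ^{md} × ℝ`. -/
abbrev Weights (n m d : ℕ) : Type := Fin n → (Fin m × Fin d → ℝ) × ℝ

/-- The matrix with rows `w_1, …, w_n`. -/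
def Weights.mat {n m d : ℕ} (ω : Weights n m d) : Matrix (Fin n) (Fin m × Fin d) ℝ :=
  Matrix.of fun i => (ω i).1

/-- The vector `(b_1, …, b_n)`. -/
def Weights.bias {n m d : ℕ} (ω : Weights n m d) : Fin n → ℝ := fun i => (ω i).2

/-- The joint law of `n` i.i.d. samples from `μ^{md+1}`. -/
def weightLaw (μ : Measure ℝ) [IsProbabilityMeasure μ] (n m d : ℕ) : Measure (Weights n m d) :=
  Measure.pi fun _ : Fin n => (Measure.pi fun _ : Fin m × Fin d => μ).prod μ

/-- The reservoir matrix `c W P Wᵀ`. -/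
def reservoirMatrix {n m d : ℕ} (c : ℝ) (ω : Weights n m d) : Matrix (Fin n) (Fin n) ℝ :=
  ω.mat * (c • (shiftMatrix m d * ω.matᵀ))

/-- The input weight matrix `W Q`. -/
def inputWeights {n m d : ℕ} (ω : Weights n m d) : Matrix (Fin n) (Fin d) ℝ :=
  ω.mat * inputMatrix m d

end EchoState

end

noncomputable section

namespace EchoState

/-! With `c = 2/(n M₂)` and `x_t = c P Wᵀ s_{t-1} + Q u_t`, the network reads `s_t = σ(W x_t + b)`,
so that `x_t = P A(x_{t-1}) + Q u_t` for the autoencoder `A(x) = c Wᵀ σ(W x + b)`. If `A` were the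
identity, this would be a shift register and `x_t` would store exactly the last `m` inputs. It
therefore suffices that `A` is uniformly close to the identity on `[-2,2]^{md}` and that some
readout `a · σ(W x + b)` approximates a prescribed continuous function there.

The first property comes from `integral_relu_mul_weight`: symmetry gives `E[σ(w·x+b) w] = (M₂/2) x`,
and the strong law in a space of continuous functions makes the convergence uniform in `x`
(`ae_eventually_autoencoder`). The second holds because the samples are almost surely dense in the
support, and ReLU neurons with parameters in a ball span a dense subspace
(`submodule_eq_top_of_feature_mem`).

Neither property makes the reservoir a contraction. Solutions come instead from compactness:
approximate shifting maps boxes around the delay vectors into one another, and a backward orbit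
through the boxes exists (`exists_solution_near_delayVector`). Finally, `exists_finite_memory`
replaces `F` by a continuous function of finitely many past inputs. -/

/-! ### Backward orbits by compactness -/

theorem exists_backward_orbit_prefix {X : Type*} (N : ℕ) : ∀ (K : ℕ → Set X) (f : ℕ → X → X),
    (∀ k, (K k).Nonempty) → (∀ k, Set.MapsTo (f k) (K (k + 1)) (K k)) →
    ∃ x : ℕ → X, (∀ k, x k ∈ K k) ∧ ∀ k < N, x k = f k (x (k + 1)) := by
  induction N with
  | zero =>
    intro K f hK _
    choose x hx using hK
    exact ⟨x, hx, by simp⟩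
  | succ N ih =>
    intro K f hK hf
    obtain ⟨x, hx, hxf⟩ := ih (fun k => K (k + 1)) (fun k => f (k + 1)) (fun k => hK _)
      (fun k => hf _)
    -- An orbit of the shifted system is extended by one forced point in front.
    refine ⟨fun k => Nat.casesOn k (f 0 (x 0)) x, ?_, ?_⟩
    · rintro (_ | k)
      · exact hf 0 (hx 0)
      · exact hx k
    · rintro (_ | k) hk
      · rfl
      · exact hxf k (by omega)

/-- An inverse sequence of nonempty compact sets has a thread. -/
theorem exists_backward_orbit {X : Type*} [TopologicalSpace X] [T2Space X]
    (K : ℕ → Set X) (f : ℕ → X → X) (hc : ∀ k, IsCompact (K k)) (hK : ∀ k, (K k).Nonempty)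
    (hf : ∀ k, Set.MapsTo (f k) (K (k + 1)) (K k)) (hcont : ∀ k, Continuous (f k)) :
    ∃ x : ℕ → X, (∀ k, x k ∈ K k) ∧ ∀ k, x k = f k (x (k + 1)) := by
  let C : ℕ → Set (ℕ → X) := fun N =>
    Set.univ.pi K ∩ ⋂ k, ⋂ (_ : k < N), {x | x k = f k (x (k + 1))}
  have hpi : IsCompact (Set.univ.pi K) := isCompact_univ_pi hc
  have hclosed : ∀ N, IsClosed (C N) := fun N =>
    hpi.isClosed.inter <| isClosed_iInter fun k => isClosed_iInter fun _ =>
      isClosed_eq (continuous_apply k) ((hcont k).comp (continuous_apply (k + 1)))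
  have hne : (⋂ N, C N).Nonempty := by
    refine IsCompact.nonempty_iInter_of_directed_nonempty_isCompact_isClosed C ?_ ?_ ?_ hclosed
    · refine Antitone.directed_ge fun N N' h => ?_
      refine Set.inter_subset_inter_right _ fun x hx => ?_
      simp only [Set.mem_iInter] at hx ⊢
      exact fun k hk => hx k (hk.trans_le h)
    · intro N
      obtain ⟨x, hx, hxf⟩ := exists_backward_orbit_prefix N K f hK hf
      exact ⟨x, fun k _ => hx k, by simpa using hxf⟩
    · exact fun N => hpi.of_isClosed_subset (hclosed N) Set.inter_subset_left
  obtain ⟨x, hx⟩ := hne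
  simp only [C, Set.mem_iInter, Set.mem_inter_iff, Set.mem_ofPred_eq] at hx
  exact ⟨x, fun k => (hx 0).1 k trivial, fun k => (hx (k + 1)).2 k (Nat.lt_succ_self k)⟩

/-! ### The reservoir as an approximate shift register -/

/-- The time `-k`. -/
def NonposInt.neg (k : ℕ) : NonposInt := ⟨-(k : ℤ), Set.mem_Iic.2 (by omega)⟩

/-- The delay vector at time `-k`: its last block is the input at that time, and going up one block
goes back one time step. -/
def delayVector {d : ℕ} (m : ℕ) (u : NonposInt → Cube d) (k : ℕ) : Fin m × Fin d → ℝ :=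
  fun p => u (NonposInt.neg (k + (m - 1 - p.1))) p.2

theorem abs_delayVector_le {d m : ℕ} (u : NonposInt → Cube d) (k : ℕ) (p : Fin m × Fin d) :
    |delayVector m u k p| ≤ 1 :=
  abs_le.2 (u (NonposInt.neg (k + (m - 1 - p.1))) p.2).2

theorem shiftMatrix_mulVec {m d : ℕ} (z : Fin m × Fin d → ℝ) (p : Fin m × Fin d) :
    (shiftMatrix m d *ᵥ z) p = if h : (p.1 : ℕ) + 1 < m then z (⟨p.1 + 1, h⟩, p.2) else 0 := by
  simp only [mulVec, dotProduct, shiftMatrix, of_apply, ite_mul, one_mul, zero_mul]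
  split_ifs with h
  · rw [Finset.sum_eq_single (⟨p.1 + 1, h⟩, p.2)]
    · simp
    · rintro ⟨i, l⟩ - hne
      rw [if_neg]
      rintro ⟨h1, h2⟩
      exact hne (Prod.ext (Fin.ext h1) h2.symm)
    · simp
  · refine Finset.sum_eq_zero fun q _ => if_neg fun hq => h ?_
    have := q.1.2
    omega

theorem inputMatrix_mulVec {m d : ℕ} (v : Fin d → ℝ) (p : Fin m × Fin d) :
    (inputMatrix m d *ᵥ v) p = if (p.1 : ℕ) + 1 = m then v p.2 else 0 := by
  simp only [mulVec, dotProduct, inputMatrix, of_apply, ite_mul, one_mul, zero_mul]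
  split_ifs with h <;> simp [h]

/-- The hidden layer `σ(W x + b)`. -/
def hidden {n m d : ℕ} (ω : Weights n m d) (x : Fin m × Fin d → ℝ) : Fin n → ℝ :=
  fun i => relu ((ω.mat *ᵥ x + ω.bias) i)

theorem continuous_relu : Continuous relu := continuous_id.max continuous_const

theorem continuous_hidden {n m d : ℕ} (ω : Weights n m d) : Continuous (hidden ω) := by
  refine continuous_pi fun i => continuous_relu.comp ?_
  exact (continuous_apply i).comp ((continuous_const.matrix_mulVec continuous_id).add
    continuous_const)

/-- If the autoencoder `x ↦ c Wᵀ σ(W x + b)` is close to the identity on `[-2,2]^{md}`, then the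
echo state network has a solution driven by a vector close to the delay vector. -/
theorem exists_solution_near_delayVector {n m d : ℕ} (c η : ℝ) (hη : 0 ≤ η) (hmη : m * η ≤ 1)
    (ω : Weights n m d)
    (hω : ∀ x : Fin m × Fin d → ℝ, (∀ p, |x p| ≤ 2) →
      ∀ p, |(c • (ω.matᵀ *ᵥ hidden ω x)) p - x p| ≤ η)
    (u : NonposInt → Cube d) :
    ∃ s : NonposInt → Fin n → ℝ,
      IsSolution relu (reservoirMatrix c ω) (inputWeights ω) ω.bias u s ∧
      ∃ x : Fin m × Fin d → ℝ, s NonposInt.last = hidden ω x ∧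
        ∀ p, |x p - delayVector m u 0 p| ≤ m * η := by
  -- An entry of block `p` entered at the last block and was shifted `m - 1 - p` times, each time at
  -- a cost of at most `η`. The last block is exact.
  let K : ℕ → Set (Fin m × Fin d → ℝ) := fun k => Set.univ.pi fun p =>
    Metric.closedBall (delayVector m u k p) ((m - 1 - p.1 : ℕ) * η)
  have hrad : ∀ p : Fin m × Fin d, ((m - 1 - p.1 : ℕ) : ℝ) * η ≤ m * η := fun p =>
    mul_le_mul_of_nonneg_right (by exact_mod_cast (by omega)) hη
  have hmem : ∀ k x, x ∈ K k → ∀ p,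
      |x p - delayVector m u k p| ≤ ((m - 1 - p.1 : ℕ) : ℝ) * η := fun k x hx p => by
    have := hx p trivial
    rwa [Metric.mem_closedBall, Real.dist_eq] at this
  let f : ℕ → (Fin m × Fin d → ℝ) → (Fin m × Fin d → ℝ) := fun k x =>
    shiftMatrix m d *ᵥ (c • (ω.matᵀ *ᵥ hidden ω x)) +
      inputMatrix m d *ᵥ fun l => (u (NonposInt.neg k) l : ℝ)
  obtain ⟨x, hxK, hxf⟩ := exists_backward_orbit K f
    (fun k => isCompact_univ_pi fun p => isCompact_closedBall _ _)
    (fun k => ⟨delayVector m u k, fun p _ => Metric.mem_closedBall_self (by positivity)⟩)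
    (by
      intro k x hx p _
      rw [Metric.mem_closedBall, Real.dist_eq]
      simp only [f, Pi.add_apply, shiftMatrix_mulVec, inputMatrix_mulVec]
      have hp := p.1.2
      by_cases h : (p.1 : ℕ) + 1 < m
      · rw [dif_pos h, if_neg (by omega), add_zero]
        -- Block `p` at time `-k` is the decoded block `p + 1` of time `-(k+1)`, and both hold the
        -- same input.
        set q : Fin m × Fin d := (⟨p.1 + 1, h⟩, p.2)
        have hq : delayVector m u (k + 1) q = delayVector m u k p := by
          simp only [delayVector, q]
          congr 3
          omega
        have hx1 := hmem _ _ hx q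
        rw [hq] at hx1
        have hx2 : |x q| ≤ 2 := by
          have h1 := abs_delayVector_le u k p
          have h2 := hrad q
          have := abs_sub_abs_le_abs_sub (x q) (delayVector m u k p)
          linarith
        -- Inputs are bounded by `1` and the accumulated error by `m * η ≤ 1`, so the autoencoder
        -- bound on `[-2,2]^{md}` applies.
        have hx3 : ∀ q, |x q| ≤ 2 := fun q => by
          have h1 := abs_delayVector_le u (k + 1) q
          have h2 := hrad q
          have h3 := hmem _ _ hx q
          have := abs_sub_abs_le_abs_sub (x q) (delayVector m u (k + 1) q)
          linarith
        have hx4 := hω x hx3 q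
        have : ((m - 1 - p.1 : ℕ) : ℝ) = ((m - 1 - q.1 : ℕ) : ℝ) + 1 := by
          have : m - 1 - (p.1 : ℕ) = m - 1 - (q.1 : ℕ) + 1 := by
            simp only [q]; omega
          exact_mod_cast this
        rw [this, add_mul, one_mul]
        exact (abs_sub_le _ (x q) _).trans (by linarith)
      · have h' : (p.1 : ℕ) + 1 = m := by omega
        rw [dif_neg h, if_pos h', zero_add]
        have : m - 1 - (p.1 : ℕ) = 0 := by omega
        simp [delayVector, this])
    (fun k => by
      refine Continuous.add (continuous_const.matrix_mulVec ?_) continuous_const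
      exact (continuous_const.matrix_mulVec (continuous_hidden ω)).const_smul c)
  refine ⟨fun t => hidden ω (x (t : ℤ).natAbs), ?_, x 0, rfl, fun p =>
    (hmem 0 _ (hxK 0) p).trans (hrad p)⟩
  intro t i
  have ht : (t : ℤ) ≤ 0 := t.2
  have h1 : ((t.pred : NonposInt) : ℤ).natAbs = (t : ℤ).natAbs + 1 := by
    simp only [NonposInt.pred]; omega
  have h2 : NonposInt.neg (t : ℤ).natAbs = t := Subtype.ext (by simp only [NonposInt.neg]; omega)
  have h3 := hxf (t : ℤ).natAbs
  simp only [f, h2] at h3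
  simp only [h1]
  rw [hidden]
  congr 2
  conv_lhs => rw [h3]
  simp only [reservoirMatrix, inputWeights, mulVec_add, mulVec_mulVec, Matrix.mulVec_smul,
    Matrix.mul_smul, Matrix.smul_mulVec]

/-! ### Universality of ReLU neurons -/

/-- Taylor's formula for `exp` at `-R` with integral remainder. The linear term is written as a
ReLU, so that `exp` becomes a superposition of neurons. -/
theorem intervalIntegral_exp_mul_relu {R y : ℝ} (hy : |y| ≤ R) :
    ∫ c in (-R)..R, Real.exp c * relu (y - c) =
      Real.exp y - Real.exp (-R) * (1 + relu (y + R)) := by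
  obtain ⟨h1, h2⟩ := abs_le.1 hy
  have hcont : Continuous fun c => Real.exp c * relu (y - c) :=
    Real.continuous_exp.mul (continuous_relu.comp (continuous_const.sub continuous_id))
  rw [← intervalIntegral.integral_add_adjacent_intervals (hcont.intervalIntegrable (-R) y)
    (hcont.intervalIntegrable y R)]
  have hleft : ∫ c in (-R)..y, Real.exp c * relu (y - c) =
      ∫ c in (-R)..y, (Real.exp c * (y - c)) := by
    refine intervalIntegral.integral_congr fun c hc => ?_
    rw [Set.uIcc_of_le h1] at hc
    simp only [relu]
    rw [max_eq_left (by linarith [hc.2])]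
  have hright : ∫ c in y..R, Real.exp c * relu (y - c) = ∫ c in y..R, (0 : ℝ) := by
    refine intervalIntegral.integral_congr fun c hc => ?_
    rw [Set.uIcc_of_le h2] at hc
    simp only [relu]
    rw [max_eq_right (by linarith [hc.1]), mul_zero]
  have hderiv : ∀ c ∈ Set.uIcc (-R) y,
      HasDerivAt (fun c => Real.exp c * (y - c) + Real.exp c) (Real.exp c * (y - c)) c := by
    intro c _
    have h := ((Real.hasDerivAt_exp c).mul ((hasDerivAt_id c).const_sub y)).add
      (Real.hasDerivAt_exp c)
    refine h.congr_deriv ?_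
    simp only [id]
    ring
  rw [hleft, hright, intervalIntegral.integral_zero, add_zero,
    intervalIntegral.integral_eq_sub_of_hasDerivAt hderiv
      (Continuous.intervalIntegrable (by fun_prop) _ _), relu, max_eq_left (by linarith)]
  ring

section Feature

variable {ι : Type*} [Fintype ι] (K : Set (ι → ℝ))

/-- The neuron `x ↦ σ(w · x + b)` on `K`, for `θ = (w, b)`. -/
def feature (θ : (ι → ℝ) × ℝ) : C(K, ℝ) where
  toFun x := relu (θ.1 ⬝ᵥ (x : ι → ℝ) + θ.2)
  continuous_toFun := continuous_relu.comp
    ((continuous_const.dotProduct continuous_subtype_val).add continuous_const)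

/-- Currying turns joint continuity in parameter and point into continuity for the compact-open
topology. -/
theorem continuous_feature : Continuous (feature K) := by
  let g : C(((ι → ℝ) × ℝ) × K, ℝ) :=
    ⟨fun p => relu (p.1.1 ⬝ᵥ (p.2 : ι → ℝ) + p.1.2), continuous_relu.comp
      (((continuous_fst.comp continuous_fst).dotProduct
        (continuous_subtype_val.comp continuous_snd)).add (continuous_snd.comp continuous_fst))⟩
  exact g.curry.continuous

theorem relu_mul {c : ℝ} (hc : 0 ≤ c) (x : ℝ) : relu (c * x) = c * relu x := by
  simp [relu, mul_max_of_nonneg _ _ hc]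

theorem feature_smul {c : ℝ} (hc : 0 ≤ c) (θ : (ι → ℝ) × ℝ) :
    feature K (c • θ) = c • feature K θ := by
  ext x
  simp [feature, ← relu_mul hc, mul_add]

/-- Positive homogeneity of ReLU: every parameter can be scaled into the ball, and a subspace
absorbs the factor. -/
theorem feature_mem_of_norm_le {r : ℝ} (hr : 0 < r) (S : Submodule ℝ C(K, ℝ))
    (hS : ∀ θ, ‖θ‖ ≤ r → feature K θ ∈ S) (θ : (ι → ℝ) × ℝ) : feature K θ ∈ S := by
  have hpos : 0 < r / (‖θ‖ + 1) := by positivity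
  have hmem := hS ((r / (‖θ‖ + 1)) • θ) (by
    rw [norm_smul, Real.norm_of_nonneg hpos.le, div_mul_eq_mul_div, div_le_iff₀ (by positivity)]
    exact mul_le_mul_of_nonneg_left (by linarith) hr.le)
  rw [feature_smul K hpos.le] at hmem
  exact (S.smul_mem_iff hpos.ne').1 hmem

/-- The function `x ↦ exp(w · x)` on `K`. -/
def expFeature (w : ι → ℝ) : C(K, ℝ) where
  toFun x := Real.exp (w ⬝ᵥ (x : ι → ℝ))
  continuous_toFun := Real.continuous_exp.comp (continuous_const.dotProduct continuous_subtype_val)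

variable [CompactSpace K]

theorem expFeature_mem (S : Submodule ℝ C(K, ℝ)) (hclosed : IsClosed (S : Set C(K, ℝ)))
    (hS : ∀ θ, feature K θ ∈ S) (w : ι → ℝ) : expFeature K w ∈ S := by
  let L : C(K, ℝ) :=
    ⟨fun x => w ⬝ᵥ (x : ι → ℝ), continuous_const.dotProduct continuous_subtype_val⟩
  -- The extra `1` keeps the interval nondegenerate when `L = 0`, as averaging over it requires.
  set R : ℝ := ‖L‖ + 1
  have hR : -R < R := by
    have := norm_nonneg L
    simp only [R]; linarith
  let g : ℝ → C(K, ℝ) := fun c => Real.exp c • feature K (w, -c)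
  have hg : Continuous g := Real.continuous_exp.smul ((continuous_feature K).comp (by fun_prop))
  have hint : ∫ c in (-R)..R, g c ∈ S := by
    rw [intervalIntegral.integral_of_le hR.le]
    have hvol : volume (Set.Ioc (-R) R) ≠ 0 := by
      rw [Real.volume_Ioc]
      simpa using by linarith
    -- A closed convex set contains the averages of functions valued in it. The integral is a
    -- nonzero multiple of such an average.
    have hmem := S.convex.set_average_mem (μ := volume) (t := Set.Ioc (-R) R) (f := g) hclosed hvol
      (by simp) (Filter.Eventually.of_forall fun c => S.smul_mem _ (hS _))
      hg.integrableOn_Ioc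
    rw [setAverage_eq] at hmem
    refine (S.smul_mem_iff ?_).1 hmem
    rw [measureReal_def, Real.volume_Ioc]
    have : 0 < R - -R := by linarith
    rw [ENNReal.toReal_ofReal this.le]
    exact (inv_pos.2 this).ne'
  have heq : expFeature K w =
      (∫ c in (-R)..R, g c) + Real.exp (-R) • (feature K (0, 1) + feature K (w, R)) := by
    ext x
    have hx : |w ⬝ᵥ (x : ι → ℝ)| ≤ R := (L.norm_coe_le_norm x).trans (by simp [R])
    have heval : (∫ c in (-R)..R, g c) x = ∫ c in (-R)..R, g c x :=
      ((ContinuousMap.evalCLM ℝ x).intervalIntegral_comp_comm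
        (hg.intervalIntegrable (-R) R)).symm
    have := intervalIntegral_exp_mul_relu hx
    rw [ContinuousMap.add_apply, heval]
    simp only [g, ContinuousMap.add_apply, ContinuousMap.smul_apply, feature,
      ContinuousMap.coe_mk, smul_eq_mul, ← sub_eq_add_neg, this, expFeature, zero_dotProduct,
      zero_add]
    simp [relu]
  rw [heq]
  exact S.add_mem hint (S.smul_mem _ (S.add_mem (hS _) (hS _)))

/-- Universal approximation: ReLU neurons with parameters in a ball span a dense subspace. -/
theorem submodule_eq_top_of_feature_mem {r : ℝ} (hr : 0 < r) (S : Submodule ℝ C(K, ℝ))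
    (hclosed : IsClosed (S : Set C(K, ℝ))) (hS : ∀ θ, ‖θ‖ ≤ r → feature K θ ∈ S) : S = ⊤ := by
  have hexp := expFeature_mem K S hclosed (feature_mem_of_norm_le K hr S hS)
  -- Exponentials are closed under multiplication, so the algebra they generate is just their span
  -- and lies in `S`. Stone–Weierstrass then applies.
  let M : Submonoid C(K, ℝ) :=
    { carrier := Set.range (expFeature K)
      one_mem' := ⟨0, by ext x; simp [expFeature]⟩
      mul_mem' := by
        rintro _ _ ⟨v, rfl⟩ ⟨w, rfl⟩
        exact ⟨v + w, by ext x; simp [expFeature, add_dotProduct, Real.exp_add]⟩ }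
  let A : Subalgebra ℝ C(K, ℝ) := Algebra.adjoin ℝ (M : Set C(K, ℝ))
  have hAS : (A : Set C(K, ℝ)) ⊆ S := by
    have h : Subalgebra.toSubmodule A ≤ S := by
      rw [Algebra.adjoin_eq_span, Submonoid.closure_eq, Submodule.span_le]
      rintro _ ⟨w, rfl⟩
      exact hexp w
    exact h
  have hsep : A.SeparatesPoints := by
    classical
    intro x y hxy
    obtain ⟨i, hi⟩ := Function.ne_iff.1 (Subtype.coe_injective.ne hxy)
    refine ⟨_, ⟨expFeature K (Pi.single i 1), Algebra.subset_adjoin ⟨_, rfl⟩, rfl⟩, ?_⟩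
    simpa [expFeature] using hi
  have htop := ContinuousMap.subalgebra_topologicalClosure_eq_top_of_separatesPoints A hsep
  refine eq_top_iff.2 fun f _ => ?_
  have hf : f ∈ A.topologicalClosure := htop ▸ trivial
  exact closure_minimal hAS hclosed hf

end Feature

/-! ### Infinite i.i.d. sequences -/

open ProbabilityTheory Filter Topology

/-- The law of an infinite sequence of i.i.d. samples. -/
abbrev sampleLaw {Θ : Type*} [MeasurableSpace Θ] (ν : Measure Θ) [IsProbabilityMeasure ν] :
    Measure (ℕ → Θ) := Measure.infinitePi fun _ : ℕ => ν

section Samples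

variable {Θ : Type*} [MeasurableSpace Θ] (ν : Measure Θ) [IsProbabilityMeasure ν]

theorem ae_tendsto_average {E : Type*} [NormedAddCommGroup E] [NormedSpace ℝ E] [CompleteSpace E]
    [MeasurableSpace E] [BorelSpace E] {f : Θ → E} (hf : Measurable f) (hint : Integrable f ν) :
    ∀ᵐ ω ∂sampleLaw ν, Tendsto (fun n : ℕ => (n : ℝ)⁻¹ • ∑ i ∈ Finset.range n, f (ω i)) atTop
      (𝓝 (∫ θ, f θ ∂ν)) := by
  have hmp : ∀ i, MeasurePreserving (Function.eval i) (sampleLaw ν) ν := fun i =>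
    measurePreserving_eval_infinitePi (fun _ : ℕ => ν) i
  have hmeas : ∀ i, Measurable fun ω : ℕ → Θ => f (ω i) := fun i => hf.comp (measurable_pi_apply i)
  have hmap : ∀ i, (sampleLaw ν).map (fun ω => f (ω i)) = ν.map f := fun i => by
    conv_rhs => rw [← (hmp i).map_eq]
    rw [Measure.map_map hf (measurable_pi_apply i)]
    rfl
  have hlln := strong_law_ae (μ := sampleLaw ν) (fun i ω => f (ω i))
    ((hmp 0).integrable_comp_of_integrable hint)
    (fun i j hij => (iIndepFun_infinitePi (P := fun _ : ℕ => ν) (X := fun _ => f)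
      fun _ => hf).indepFun hij)
    (fun i => ⟨(hmeas i).aemeasurable, (hmeas 0).aemeasurable, by rw [hmap, hmap]⟩)
  have heq : ∫ ω, f (ω 0) ∂sampleLaw ν = ∫ θ, f θ ∂ν := by
    conv_rhs => rw [← (hmp 0).map_eq]
    rw [integral_map (measurable_pi_apply 0).aemeasurable (by rw [(hmp 0).map_eq]; exact hint.1)]
  rwa [heq] at hlln

/-- By the strong law the frequency of visits to `U` tends to `ν U`, which is not zero. -/
theorem ae_exists_sample_mem {U : Set Θ} (hU : MeasurableSet U) (hpos : ν U ≠ 0) :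
    ∀ᵐ ω ∂sampleLaw ν, ∃ i, ω i ∈ U := by
  have h := ae_tendsto_average ν (f := U.indicator fun _ => (1 : ℝ))
    (measurable_const.indicator hU) ((integrable_const 1).indicator hU)
  filter_upwards [h] with ω hω
  by_contra! hno
  simp only [Set.indicator_of_notMem (hno _), Finset.sum_const_zero, smul_zero] at hω
  have := tendsto_nhds_unique hω tendsto_const_nhds
  rw [integral_indicator hU] at this
  simp [measureReal_def, ENNReal.toReal_eq_zero_iff, hpos] at this

/-- A countable basis leaves only countably many almost sure events to intersect. -/
theorem ae_support_subset_closure_range [TopologicalSpace Θ] [SecondCountableTopology Θ]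
    [OpensMeasurableSpace Θ] :
    ∀ᵐ ω ∂sampleLaw ν, ν.support ⊆ closure (Set.range ω) := by
  have hb := TopologicalSpace.isBasis_countableBasis Θ
  have h : ∀ᵐ ω ∂sampleLaw ν, ∀ U ∈ TopologicalSpace.countableBasis Θ, ν U ≠ 0 → ∃ i, ω i ∈ U := by
    rw [ae_ball_iff (TopologicalSpace.countable_countableBasis Θ)]
    intro U hU
    by_cases h0 : ν U = 0
    · simp [h0]
    · filter_upwards [ae_exists_sample_mem ν (hb.isOpen hU).measurableSet h0] with ω hω _ using hω
  filter_upwards [h] with ω hω θ hθ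
  rw [hb.mem_closure_iff]
  intro U hU hθU
  obtain ⟨i, hi⟩ := hω U hU
    ((Measure.mem_support_iff_forall θ).1 hθ U ((hb.isOpen hU).mem_nhds hθU)).ne'
  exact ⟨ω i, hi, i, rfl⟩

theorem map_sampleLaw (n : ℕ) :
    (sampleLaw ν).map (fun ω (i : Fin n) => ω i) = Measure.pi fun _ : Fin n => ν := by
  rw [Measure.map_infinitePi_infinitePi_of_inj (P := fun _ : ℕ => ν) (f := fun i : Fin n => (i : ℕ))
    Fin.val_injective, Measure.infinitePi_eq_pi]

/-- An event about `n` samples that almost surely holds for all large `n` has large probability for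
some `n`. -/
theorem exists_le_pi_of_ae_eventually (E : ∀ n : ℕ, Set (Fin n → Θ))
    (hE : ∀ n, MeasurableSet (E n))
    (h : ∀ᵐ ω ∂sampleLaw ν, ∀ᶠ n in atTop, (fun i : Fin n => ω i) ∈ E n)
    {δ : ℝ} (hδ : 0 < δ) :
    ∃ n, 0 < n ∧ ENNReal.ofReal (1 - δ) ≤ (Measure.pi fun _ : Fin n => ν) (E n) := by
  have hm : ∀ n : ℕ, Measurable fun (ω : ℕ → Θ) (i : Fin n) => ω i := fun n => by fun_prop
  have ht := tendsto_measure_of_ae_tendsto_indicator_of_isFiniteMeasure (μ := sampleLaw ν) atTop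
    (A := Set.univ) (As := fun n => (fun ω (i : Fin n) => ω i) ⁻¹' E n) MeasurableSet.univ
    (fun n => hm n (hE n)) (by
      filter_upwards [h] with ω hω
      filter_upwards [hω] with n hn
      simpa using hn)
  rw [measure_univ] at ht
  have hlt : ENNReal.ofReal (1 - δ) < 1 := by
    rw [ENNReal.ofReal_lt_one]; linarith
  obtain ⟨n, hn, hpos⟩ := ((ht.eventually (lt_mem_nhds hlt)).and (eventually_gt_atTop 0)).exists
  refine ⟨n, hpos, ?_⟩
  rw [← map_sampleLaw ν n, Measure.map_apply (hm n) (hE n)]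
  exact hn.le

end Samples

/-! ### Random features and readouts -/

section Readout

variable {ι : Type*} [Fintype ι] (K : Set (ι → ℝ))

theorem exists_readout_of_mem_span_range {ω : ℕ → (ι → ℝ) × ℝ} {g : C(K, ℝ)}
    (hg : g ∈ Submodule.span ℝ (Set.range fun i => feature K (ω i))) :
    ∀ᶠ n : ℕ in atTop, ∃ a : Fin n → ℝ, ∑ i, a i • feature K (ω i) = g := by
  obtain ⟨c, rfl⟩ := Finsupp.mem_span_range_iff_exists_finsupp.1 hg
  filter_upwards [eventually_gt_atTop (c.support.sup id)] with n hn
  refine ⟨fun i => c i, ?_⟩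
  rw [Fin.sum_univ_eq_sum_range (fun i => c i • feature K (ω i)) n, Finsupp.sum]
  refine (Finset.sum_subset ?_ ?_).symm
  · exact fun i hi => Finset.mem_range.2 ((Finset.le_sup (f := id) hi).trans_lt hn)
  · intro i _ hi
    rw [Finsupp.notMem_support_iff.1 hi, zero_smul]

variable [CompactSpace K]

/-- Random ReLU features are almost surely universal. -/
theorem ae_eventually_exists_readout (ν : Measure ((ι → ℝ) × ℝ)) [IsProbabilityMeasure ν]
    {r : ℝ} (hr : 0 < r) (hν : ∀ θ, ‖θ‖ ≤ r → θ ∈ ν.support) (H : C(K, ℝ))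
    {ε : ℝ} (hε : 0 < ε) :
    ∀ᵐ ω ∂sampleLaw ν, ∀ᶠ n : ℕ in atTop,
      ∃ a : Fin n → ℝ, ‖H - ∑ i, a i • feature K (ω i)‖ < ε := by
  filter_upwards [ae_support_subset_closure_range ν] with ω hω
  let S := (Submodule.span ℝ (Set.range fun i => feature K (ω i))).topologicalClosure
  have hS : S = ⊤ := by
    refine submodule_eq_top_of_feature_mem K hr S (Submodule.isClosed_topologicalClosure _) ?_
    intro θ hθ
    have h1 := image_closure_subset_closure_image (continuous_feature K)
      (Set.mem_image_of_mem _ (hω (hν θ hθ)))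
    rw [← Set.range_comp] at h1
    exact closure_mono Submodule.subset_span h1
  have hH : H ∈ S := hS ▸ trivial
  obtain ⟨g, hg, hdist⟩ := Metric.mem_closure_iff.1 hH ε hε
  filter_upwards [exists_readout_of_mem_span_range K hg] with n ⟨a, ha⟩
  exact ⟨a, by rwa [ha, ← dist_eq_norm]⟩

/-- The union over readouts is uncountable, so measurability of this event is obtained through
openness. -/
theorem isOpen_exists_readout (n : ℕ) (H : C(K, ℝ)) (ε : ℝ) :
    IsOpen {ω : Fin n → (ι → ℝ) × ℝ | ∃ a : Fin n → ℝ, ‖H - ∑ i, a i • feature K (ω i)‖ < ε} := by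
  have : {ω : Fin n → (ι → ℝ) × ℝ | ∃ a : Fin n → ℝ, ‖H - ∑ i, a i • feature K (ω i)‖ < ε} =
      ⋃ a : Fin n → ℝ, {ω | ‖H - ∑ i, a i • feature K (ω i)‖ < ε} := by
    ext ω; simp
  rw [this]
  refine isOpen_iUnion fun a => isOpen_lt (Continuous.norm ?_) continuous_const
  exact continuous_const.sub (continuous_finsetSum _ fun i _ =>
    ((continuous_feature K).comp (continuous_apply i)).const_smul (a i))

end Readout

/-! ### Support and moments of the weight law -/

/-- The law `μ^{ι} ⊗ μ` of a single weight sample. -/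
abbrev neuronLaw (μ : Measure ℝ) [IsProbabilityMeasure μ] (ι : Type*) [Fintype ι] :
    Measure ((ι → ℝ) × ℝ) := (Measure.pi fun _ : ι => μ).prod μ

section Moments

variable (μ : Measure ℝ)

theorem integral_id_eq_zero (hsymm : μ.map (fun x : ℝ => -x) = μ) : ∫ x, x ∂μ = 0 := by
  have h : ∫ x, x ∂μ = ∫ x, -x ∂μ := by
    conv_lhs => rw [← hsymm]
    exact integral_map measurable_neg.aemeasurable aestronglyMeasurable_id
  rw [integral_neg] at h
  linarith

/-- The support point `r` has a neighbourhood of positive mass away from zero. This makes dividing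
by `M₂` legitimate. -/
theorem second_moment_pos {r : ℝ} (hr : 0 < r) (hsupp : Set.Icc (-r) r ⊆ μ.support)
    (hint : Integrable (fun x : ℝ => x ^ 2) μ) : 0 < ∫ x, x ^ 2 ∂μ := by
  rw [integral_pos_iff_support_of_nonneg (fun x => sq_nonneg x) hint]
  refine (Measure.mem_support_iff_forall r).1 (hsupp ⟨by linarith, le_rfl⟩) _ ?_
  filter_upwards [isOpen_ne.mem_nhds hr.ne'] with x hx using pow_ne_zero 2 hx

variable [IsProbabilityMeasure μ] {ι : Type*} [Fintype ι]

theorem mem_support_neuronLaw {r : ℝ} (hsupp : Set.Icc (-r) r ⊆ μ.support)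
    (θ : (ι → ℝ) × ℝ) (hθ : ‖θ‖ ≤ r) : θ ∈ (neuronLaw μ ι).support := by
  have hmem : ∀ y : ℝ, ‖y‖ ≤ ‖θ‖ → y ∈ μ.support := fun y hy =>
    hsupp (abs_le.1 (hy.trans hθ))
  rw [Measure.mem_support_iff_forall]
  intro U hU
  obtain ⟨A, hA, B, hB, hAB⟩ := mem_nhds_prod_iff.1 hU
  rw [nhds_pi, Filter.mem_pi'] at hA
  obtain ⟨I, s, hs, hsA⟩ := hA
  refine lt_of_lt_of_le ?_ (measure_mono hAB)
  rw [Measure.prod_prod]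
  refine ENNReal.mul_pos ?_ ?_
  · refine ne_of_gt (lt_of_lt_of_le ?_ (measure_mono
      ((Set.pi_mono' (fun i _ => subset_rfl) (Set.subset_univ _)).trans hsA)))
    rw [Measure.pi_pi]
    exact CanonicallyOrderedAdd.prod_pos.2 fun i _ => (Measure.mem_support_iff_forall _).1
      (hmem _ ((norm_le_pi_norm θ.1 i).trans (norm_fst_le θ))) _ (hs i)
  · exact ((Measure.mem_support_iff_forall _).1 (hmem _ (norm_snd_le θ)) _ hB).ne'

theorem measurePreserving_neg_neuronLaw (hsymm : μ.map (fun x : ℝ => -x) = μ) :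
    MeasurePreserving (fun θ : (ι → ℝ) × ℝ => -θ) (neuronLaw μ ι) (neuronLaw μ ι) := by
  have h : MeasurePreserving (fun x : ℝ => -x) μ μ := ⟨measurable_neg, hsymm⟩
  exact (measurePreserving_pi (fun _ : ι => μ) (fun _ => μ) fun _ => h).prod h

theorem measurePreserving_weight (i : ι) :
    MeasurePreserving (fun θ : (ι → ℝ) × ℝ => θ.1 i) (neuronLaw μ ι) μ :=
  (measurePreserving_eval (fun _ : ι => μ) i).comp measurePreserving_fst

theorem memLp_weight (hint : Integrable (fun x : ℝ => x ^ 2) μ) (i : ι) :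
    MemLp (fun θ : (ι → ℝ) × ℝ => θ.1 i) 2 (neuronLaw μ ι) :=
  ((memLp_two_iff_integrable_sq aestronglyMeasurable_id).2 hint).comp_measurePreserving
    (measurePreserving_weight μ i)

theorem memLp_bias (hint : Integrable (fun x : ℝ => x ^ 2) μ) :
    MemLp (fun θ : (ι → ℝ) × ℝ => θ.2) 2 (neuronLaw μ ι) :=
  ((memLp_two_iff_integrable_sq aestronglyMeasurable_id).2 hint).comp_measurePreserving
    measurePreserving_snd

theorem integral_weight_mul_weight (hsymm : μ.map (fun x : ℝ => -x) = μ) [DecidableEq ι]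
    (i j : ι) :
    ∫ θ, θ.1 i * θ.1 j ∂neuronLaw μ ι = if i = j then ∫ x, x ^ 2 ∂μ else 0 := by
  split_ifs with h
  · subst h
    simp_rw [← sq]
    conv_rhs => rw [← (measurePreserving_weight μ i).map_eq]
    rw [integral_map (measurePreserving_weight μ i).measurable.aemeasurable
      (by fun_prop)]
  · have hfst := integral_fun_fst (μ := Measure.pi fun _ : ι => μ) (ν := μ)
      (fun w : ι → ℝ => w i * w j)
    rw [hfst]
    have hind := (iIndepFun_pi (μ := fun _ : ι => μ) (X := fun _ => (id : ℝ → ℝ))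
      fun _ => aemeasurable_id).indepFun h
    have hmul := hind.integral_fun_mul_eq_mul_integral
      (measurable_pi_apply i).aestronglyMeasurable (measurable_pi_apply j).aestronglyMeasurable
    have hzero : ∫ w : ι → ℝ, w i ∂(Measure.pi fun _ : ι => μ) = 0 := by
      rw [← integral_id_eq_zero μ hsymm]
      conv_rhs => rw [← (measurePreserving_eval (fun _ : ι => μ) i).map_eq]
      have hi : AEMeasurable (fun w : ι → ℝ => w i) (Measure.pi fun _ : ι => μ) :=
        (measurable_pi_apply i).aemeasurable
      exact (integral_map (f := fun x : ℝ => x) hi aestronglyMeasurable_id).symm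
    simp only [id] at hmul
    rw [hmul, hzero]
    simp

theorem integral_bias_mul_weight (hsymm : μ.map (fun x : ℝ => -x) = μ) (j : ι) :
    ∫ θ, θ.2 * θ.1 j ∂neuronLaw μ ι = 0 := by
  have h := integral_prod_mul (μ := Measure.pi fun _ : ι => μ) (ν := μ)
    (fun w : ι → ℝ => w j) (fun b : ℝ => b)
  simp_rw [mul_comm _ ((_ : ι → ℝ) j)]
  rw [h, integral_id_eq_zero μ hsymm, mul_zero]

theorem integrable_weight_mul_weight (hint : Integrable (fun x : ℝ => x ^ 2) μ) (i j : ι) :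
    Integrable (fun θ : (ι → ℝ) × ℝ => θ.1 i * θ.1 j) (neuronLaw μ ι) :=
  (memLp_weight μ hint i).integrable_mul (memLp_weight μ hint j)

theorem integrable_bias_mul_weight (hint : Integrable (fun x : ℝ => x ^ 2) μ) (j : ι) :
    Integrable (fun θ : (ι → ℝ) × ℝ => θ.2 * θ.1 j) (neuronLaw μ ι) :=
  (memLp_bias μ hint).integrable_mul (memLp_weight μ hint j)

theorem integrable_preactivation_mul_weight (hint : Integrable (fun x : ℝ => x ^ 2) μ)
    (x : ι → ℝ) (j : ι) :
    Integrable (fun θ : (ι → ℝ) × ℝ => (θ.1 ⬝ᵥ x + θ.2) * θ.1 j) (neuronLaw μ ι) := by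
  simp only [dotProduct, add_mul, Finset.sum_mul, mul_right_comm _ (x _)]
  exact (integrable_finsetSum _ fun i _ =>
    (integrable_weight_mul_weight μ hint i j).mul_const _).add
    (integrable_bias_mul_weight μ hint j)

theorem integral_preactivation_mul_weight (hsymm : μ.map (fun x : ℝ => -x) = μ)
    (hint : Integrable (fun x : ℝ => x ^ 2) μ) (x : ι → ℝ) (j : ι) :
    ∫ θ, (θ.1 ⬝ᵥ x + θ.2) * θ.1 j ∂neuronLaw μ ι = (∫ x, x ^ 2 ∂μ) * x j := by
  classical
  simp only [dotProduct, add_mul, Finset.sum_mul, mul_right_comm _ (x _)]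
  rw [integral_add (integrable_finsetSum _ fun i _ =>
    (integrable_weight_mul_weight μ hint i j).mul_const _)
    (integrable_bias_mul_weight μ hint j), integral_bias_mul_weight μ hsymm,
    integral_finsetSum _ fun i _ => (integrable_weight_mul_weight μ hint i j).mul_const _]
  simp [integral_mul_const, integral_weight_mul_weight μ hsymm]

theorem relu_sub_relu_neg (y : ℝ) : relu y - relu (-y) = y := by
  rcases le_total y 0 with h | h
  · simp [relu, h]
  · simp [relu, h]

theorem abs_relu_le (y : ℝ) : |relu y| ≤ |y| := by
  rcases le_total y 0 with h | h
  · simp [relu, h]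
  · simp [relu, h]

/-- The autoencoder identity: by symmetry of the weights, only the linear part of the ReLU
contributes. -/
theorem integral_relu_mul_weight (hsymm : μ.map (fun x : ℝ => -x) = μ)
    (hint : Integrable (fun x : ℝ => x ^ 2) μ) (x : ι → ℝ) (j : ι) :
    ∫ θ, relu (θ.1 ⬝ᵥ x + θ.2) * θ.1 j ∂neuronLaw μ ι = (∫ x, x ^ 2 ∂μ) / 2 * x j := by
  have hmeas : Measurable fun θ : (ι → ℝ) × ℝ => relu (θ.1 ⬝ᵥ x + θ.2) * θ.1 j := by
    have h : Continuous fun θ : (ι → ℝ) × ℝ => relu (θ.1 ⬝ᵥ x + θ.2) * θ.1 j :=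
      (continuous_relu.comp ((continuous_fst.dotProduct continuous_const).add
        continuous_snd)).mul ((continuous_apply j).comp continuous_fst)
    exact h.measurable
  have hI : Integrable (fun θ : (ι → ℝ) × ℝ => relu (θ.1 ⬝ᵥ x + θ.2) * θ.1 j)
      (neuronLaw μ ι) := by
    refine (integrable_preactivation_mul_weight μ hint x j).mono hmeas.aestronglyMeasurable
      (Eventually.of_forall fun θ => ?_)
    rw [Real.norm_eq_abs, Real.norm_eq_abs, abs_mul, abs_mul]
    exact mul_le_mul_of_nonneg_right (abs_relu_le _) (abs_nonneg _)
  have hmp := measurePreserving_neg_neuronLaw μ (ι := ι) hsymm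
  have hneg : ∫ θ, relu (θ.1 ⬝ᵥ x + θ.2) * θ.1 j ∂neuronLaw μ ι =
      ∫ θ, -(relu (-(θ.1 ⬝ᵥ x + θ.2)) * θ.1 j) ∂neuronLaw μ ι := by
    conv_lhs => rw [← hmp.map_eq]
    rw [integral_map hmp.measurable.aemeasurable hmeas.aestronglyMeasurable]
    refine integral_congr_ae (Eventually.of_forall fun θ => ?_)
    simp only [Prod.fst_neg, Prod.snd_neg, neg_dotProduct, Pi.neg_apply, neg_add, mul_neg]
  have hI' : Integrable (fun θ : (ι → ℝ) × ℝ => -(relu (-(θ.1 ⬝ᵥ x + θ.2)) * θ.1 j))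
      (neuronLaw μ ι) := by
    have h := hmp.integrable_comp_of_integrable hI
    refine h.congr (Eventually.of_forall fun θ => ?_)
    simp only [Function.comp, Prod.fst_neg, Prod.snd_neg, neg_dotProduct, Pi.neg_apply, neg_add,
      mul_neg]
  -- Both integrands have the same integral, and `σ(y) - σ(-y) = y` makes their sum linear in the
  -- preactivation. Hence the factor `1/2`.
  have hsum := integral_add hI hI'
  rw [← hneg] at hsum
  have hlin : ∫ θ, (relu (θ.1 ⬝ᵥ x + θ.2) * θ.1 j +
      -(relu (-(θ.1 ⬝ᵥ x + θ.2)) * θ.1 j)) ∂neuronLaw μ ι = (∫ x, x ^ 2 ∂μ) * x j := by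
    rw [← integral_preactivation_mul_weight μ hsymm hint x j]
    refine integral_congr_ae (Eventually.of_forall fun θ => ?_)
    simp only
    rw [← sub_eq_add_neg, ← sub_mul, relu_sub_relu_neg]
  rw [hlin] at hsum
  linarith

end Moments

/-! ### The random autoencoder -/

section Autoencoder

variable (μ : Measure ℝ) [IsProbabilityMeasure μ] {ι : Type*} [Fintype ι]

theorem norm_weights_le (θ : (ι → ℝ) × ℝ) : ‖θ‖ ≤ ∑ i, |θ.1 i| + |θ.2| := by
  have hsum : 0 ≤ ∑ i, |θ.1 i| := Finset.sum_nonneg fun i _ => abs_nonneg _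
  refine norm_prod_le_iff.2 ⟨?_, ?_⟩
  · refine (pi_norm_le_iff_of_nonneg (by positivity)).2 fun i => ?_
    have := Finset.single_le_sum (f := fun i => |θ.1 i|) (fun i _ => abs_nonneg _)
      (Finset.mem_univ i)
    exact this.trans (le_add_of_nonneg_right (abs_nonneg _))
  · exact le_add_of_nonneg_left hsum

theorem integrable_norm_sq (hint : Integrable (fun x : ℝ => x ^ 2) μ) :
    Integrable (fun θ : (ι → ℝ) × ℝ => ‖θ‖ ^ 2) (neuronLaw μ ι) := by
  have h : MemLp (fun θ : (ι → ℝ) × ℝ => ∑ i, |θ.1 i| + |θ.2|) 2 (neuronLaw μ ι) :=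
    (memLp_finsetSum _ fun i _ => (memLp_weight μ hint i).abs).add (memLp_bias μ hint).abs
  have h' : MemLp (fun θ : (ι → ℝ) × ℝ => ‖θ‖) 2 (neuronLaw μ ι) :=
    h.mono continuous_norm.aestronglyMeasurable (Eventually.of_forall fun θ => by
      rw [norm_norm]
      exact (norm_weights_le θ).trans (le_abs_self _))
  exact h'.integrable_sq

/-- The vector field `x ↦ σ(w · x + b) w` on `K`, for `θ = (w, b)`. -/
def decodedFeature (K : Set (ι → ℝ)) (θ : (ι → ℝ) × ℝ) : C(K, ι → ℝ) where
  toFun x := relu (θ.1 ⬝ᵥ (x : ι → ℝ) + θ.2) • θ.1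
  continuous_toFun := (feature K θ).continuous.smul continuous_const

theorem continuous_decodedFeature (K : Set (ι → ℝ)) : Continuous (decodedFeature K) := by
  let g : C(((ι → ℝ) × ℝ) × K, ι → ℝ) :=
    ⟨fun p => relu (p.1.1 ⬝ᵥ (p.2 : ι → ℝ) + p.1.2) • p.1.1, (continuous_relu.comp
      (((continuous_fst.comp continuous_fst).dotProduct
        (continuous_subtype_val.comp continuous_snd)).add
          (continuous_snd.comp continuous_fst))).smul (continuous_fst.comp continuous_fst)⟩
  exact g.curry.continuous

variable (ι) in
/-- The cube `[-2,2]^ι`. -/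
abbrev workingCube : Set (ι → ℝ) := Metric.closedBall 0 2

/-- Quadratic growth in `θ` is why a finite second moment suffices for Bochner integrability in the
sup norm. -/
theorem norm_decodedFeature_le (θ : (ι → ℝ) × ℝ) :
    ‖decodedFeature (workingCube ι) θ‖ ≤ (Fintype.card ι * 2 + 1) * ‖θ‖ ^ 2 := by
  refine (ContinuousMap.norm_le _ (by positivity)).2 fun x => ?_
  have hx : ‖(x : ι → ℝ)‖ ≤ 2 := mem_closedBall_zero_iff.1 x.2
  have h1 : |θ.1 ⬝ᵥ (x : ι → ℝ)| ≤ Fintype.card ι * 2 * ‖θ‖ := by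
    refine (Finset.abs_sum_le_sum_abs _ _).trans ?_
    have : ∀ i ∈ Finset.univ, |θ.1 i * (x : ι → ℝ) i| ≤ ‖θ‖ * 2 := fun i _ => by
      rw [abs_mul]
      exact mul_le_mul ((norm_le_pi_norm θ.1 i).trans (norm_fst_le θ))
        ((norm_le_pi_norm (x : ι → ℝ) i).trans hx) (abs_nonneg _) (norm_nonneg _)
    refine (Finset.sum_le_sum this).trans (le_of_eq ?_)
    rw [Finset.sum_const, Finset.card_univ, nsmul_eq_mul]
    ring
  have h2 : |relu (θ.1 ⬝ᵥ (x : ι → ℝ) + θ.2)| ≤ (Fintype.card ι * 2 + 1) * ‖θ‖ := by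
    refine (abs_relu_le _).trans ((abs_add_le _ _).trans ?_)
    have : |θ.2| ≤ ‖θ‖ := norm_snd_le θ
    linarith
  calc ‖relu (θ.1 ⬝ᵥ (x : ι → ℝ) + θ.2) • θ.1‖
      = |relu (θ.1 ⬝ᵥ (x : ι → ℝ) + θ.2)| * ‖θ.1‖ := by rw [norm_smul, Real.norm_eq_abs]
    _ ≤ (Fintype.card ι * 2 + 1) * ‖θ‖ * ‖θ‖ :=
      mul_le_mul h2 (norm_fst_le θ) (norm_nonneg _) (by positivity)
    _ = _ := by ring

theorem integrable_decodedFeature (hint : Integrable (fun x : ℝ => x ^ 2) μ) :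
    Integrable (decodedFeature (workingCube ι)) (neuronLaw μ ι) :=
  ((integrable_norm_sq μ hint).const_mul _).mono'
    (continuous_decodedFeature _).aestronglyMeasurable
    (Eventually.of_forall norm_decodedFeature_le)

/-- The inclusion of `K` as a vector field. -/
def inclusion (K : Set (ι → ℝ)) : C(K, ι → ℝ) := ⟨Subtype.val, continuous_subtype_val⟩

theorem integral_decodedFeature (hsymm : μ.map (fun x : ℝ => -x) = μ)
    (hint : Integrable (fun x : ℝ => x ^ 2) μ) :
    ∫ θ, decodedFeature (workingCube ι) θ ∂neuronLaw μ ι =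
      ((∫ x, x ^ 2 ∂μ) / 2) • inclusion (workingCube ι) := by
  ext x j
  let L : C(workingCube ι, ι → ℝ) →L[ℝ] ℝ :=
    (ContinuousLinearMap.proj j).comp (ContinuousMap.evalCLM ℝ x)
  have h := L.integral_comp_comm (integrable_decodedFeature μ (ι := ι) hint)
  exact h.symm.trans (integral_relu_mul_weight μ hsymm hint (x : ι → ℝ) j)

/-- The strong law is applied to whole vector fields in `C(K, ι → ℝ)`, so uniformity over the cube
needs no covering argument. -/
theorem ae_eventually_autoencoder (hsymm : μ.map (fun x : ℝ => -x) = μ)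
    (hint : Integrable (fun x : ℝ => x ^ 2) μ) {M₂ : ℝ} (hM₂ : ∫ x, x ^ 2 ∂μ = M₂) (hpos : 0 < M₂)
    {η : ℝ} (hη : 0 < η) :
    ∀ᵐ ω ∂sampleLaw (neuronLaw μ ι), ∀ᶠ n : ℕ in atTop,
      ‖(2 / ((n : ℝ) * M₂)) • ∑ i : Fin n, decodedFeature (workingCube ι) (ω i) -
        inclusion (workingCube ι)‖ ≤ η := by
  let _ : MeasurableSpace C(workingCube ι, ι → ℝ) := borel _
  have : BorelSpace C(workingCube ι, ι → ℝ) := ⟨rfl⟩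
  filter_upwards [ae_tendsto_average (neuronLaw μ ι)
    (continuous_decodedFeature (workingCube ι)).measurable
    (integrable_decodedFeature μ hint)] with ω hω
  have h := hω.const_smul (2 / M₂)
  rw [integral_decodedFeature μ hsymm hint, smul_smul, hM₂,
    show 2 / M₂ * (M₂ / 2) = 1 by field_simp, one_smul] at h
  filter_upwards [h.eventually (Metric.closedBall_mem_nhds _ hη)] with n hn
  rw [dist_eq_norm, smul_smul] at hn
  rwa [Fin.sum_univ_eq_sum_range (fun i => decodedFeature (workingCube ι) (ω i)) n,
    show 2 / ((n : ℝ) * M₂) = 2 / M₂ * (n : ℝ)⁻¹ by field_simp]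

end Autoencoder

/-! ### Finite memory and reduction to time zero -/

section FiniteMemory

variable {d : ℕ}

/-- The zero input vector. -/
def Cube.zero : Cube d := fun _ => ⟨0, by norm_num⟩

/-- The input sequence read off from a delay vector, clamped to the cube and zero elsewhere. -/
def ofDelayVector (m : ℕ) (x : Fin m × Fin d → ℝ) (t : ℤ) : Cube d :=
  if h : -(m : ℤ) < t ∧ t ≤ 0 then
    fun l => Set.projIcc (-1 : ℝ) 1 (by norm_num) (x (⟨m - 1 - t.natAbs, by omega⟩, l))
  else Cube.zero

theorem continuous_ofDelayVector (m : ℕ) : Continuous (ofDelayVector (d := d) m) := by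
  refine continuous_pi fun t => ?_
  by_cases h : -(m : ℤ) < t ∧ t ≤ 0
  · simp only [ofDelayVector, dif_pos h]
    exact continuous_pi fun l => continuous_projIcc.comp (continuous_apply _)
  · simp only [ofDelayVector, dif_neg h]
    exact continuous_const

theorem ofDelayVector_delayVector (m : ℕ) (v : ℤ → Cube d) (t : ℤ) :
    ofDelayVector m (delayVector m (restrictNonpos v) 0) t =
      if -(m : ℤ) < t ∧ t ≤ 0 then v t else Cube.zero := by
  unfold ofDelayVector
  split_ifs with h
  · funext l
    have : -((0 + (m - 1 - (m - 1 - t.natAbs)) : ℕ) : ℤ) = t := by omega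
    simp only [delayVector, restrictNonpos, NonposInt.neg, this, Set.projIcc_val]
  · rfl

/-- Continuous causal operators have approximately finite memory. -/
theorem exists_finite_memory {F : (ℤ → Cube d) → (ℤ → ℝ)} (hcausal : IsCausal F)
    (hcont : Continuous F) {ε : ℝ} (hε : 0 < ε) :
    ∃ (m : ℕ) (H : (Fin m × Fin d → ℝ) → ℝ), 0 < m ∧ Continuous H ∧
      ∀ v : ℤ → Cube d, |F v 0 - H (delayVector m (restrictNonpos v) 0)| < ε := by
  have hF0 : Continuous fun v => F v 0 := (continuous_apply 0).comp hcont
  have huc := CompactSpace.uniformContinuous_of_continuous hF0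
  let T : ℕ → (ℤ → Cube d) → (ℤ → Cube d) := fun m v t =>
    if -(m : ℤ) < t ∧ t ≤ 0 then v t else Cube.zero
  let P : (ℤ → Cube d) → (ℤ → Cube d) := fun v t => if t ≤ 0 then v t else Cube.zero
  -- In the product uniformity each coordinate is tested separately, and coordinate `t` agrees once
  -- `m > |t|`, for all inputs at once.
  have hT : TendstoUniformly T P atTop := by
    rw [tendstoUniformly_iff_tendsto, Pi.uniformity, tendsto_iInf]
    intro t
    rw [tendsto_comap_iff]
    have hev : ∀ᶠ q : ℕ × (ℤ → Cube d) in atTop ×ˢ ⊤, P q.2 t = T q.1 q.2 t := by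
      refine ((eventually_gt_atTop t.natAbs).prod_inl ⊤).mono fun q hq => ?_
      simp only [P, T]
      have : -(q.1 : ℤ) < t := by omega
      simp [this]
    refine tendsto_def.2 fun V hV => ?_
    filter_upwards [hev] with q hq
    simp only [Set.mem_preimage, Function.comp]
    rw [hq]
    exact refl_mem_uniformity hV
  have hev := Metric.tendstoUniformly_iff.1 (huc.comp_tendstoUniformly hT) ε hε
  obtain ⟨m, hm, hpos⟩ := (hev.and (eventually_gt_atTop 0)).exists
  refine ⟨m, fun x => F (ofDelayVector m x) 0, hpos, hF0.comp (continuous_ofDelayVector m),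
    fun v => ?_⟩
  have h1 : F v 0 = F (P v) 0 := hcausal v (P v) 0 fun j hj => by simp [P, hj]
  have h2 : ofDelayVector m (delayVector m (restrictNonpos v) 0) = T m v :=
    funext fun t => ofDelayVector_delayVector m v t
  beta_reduce
  rw [h1, h2]
  exact hm v

/-- A time-invariant operator is approximated everywhere once it is approximated at time `0`. -/
theorem exists_esn_operator {n : ℕ} {F : (ℤ → Cube d) → (ℤ → ℝ)} (hF : IsTimeInvariant F)
    {φ : ℝ → ℝ} {W₁ : Matrix (Fin n) (Fin n) ℝ} {W₂ : Matrix (Fin n) (Fin d) ℝ} {b a : Fin n → ℝ}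
    {ε : ℝ} (h : ∀ u : NonposInt → Cube d, ∃ s, IsSolution φ W₁ W₂ b u s ∧
      ∀ v : ℤ → Cube d, restrictNonpos v = u → |F v 0 - a ⬝ᵥ s NonposInt.last| ≤ ε) :
    HasSolutions φ W₁ W₂ b ∧ ∃ H, IsESNOperator φ W₁ W₂ b a H ∧
      ∀ (u : ℤ → Cube d) (t : ℤ), |F u t - H u t| ≤ ε := by
  choose s hs happrox using h
  refine ⟨fun u => ⟨s u, hs u⟩, fun u t => a ⬝ᵥ s (history u t) NonposInt.last,
    ⟨s, hs, fun _ _ => rfl⟩, fun u t => ?_⟩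
  have ht : F u t = F (timeDelay (-t) u) 0 := by rw [hF, zero_sub, neg_neg]
  rw [ht]
  exact happrox _ _ rfl

end FiniteMemory

/-! ### The event of good weights -/

section GoodSamples

variable {n m d : ℕ}

/-- The weight samples for which the autoencoder is `η`-accurate on the working cube and some
readout approximates `H` there to accuracy `ε`. -/
def goodWeights (c η ε : ℝ) (H : C(workingCube (Fin m × Fin d), ℝ)) : Set (Weights n m d) :=
  {ω | ‖c • ∑ i, decodedFeature (workingCube (Fin m × Fin d)) (ω i) - inclusion _‖ ≤ η} ∩
    {ω | ∃ a : Fin n → ℝ, ‖H - ∑ i, a i • feature (workingCube (Fin m × Fin d)) (ω i)‖ < ε}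

theorem measurableSet_goodWeights (c η ε : ℝ) (H : C(workingCube (Fin m × Fin d), ℝ)) :
    MeasurableSet (goodWeights (n := n) c η ε H) := by
  refine MeasurableSet.inter (IsClosed.measurableSet ?_)
    (isOpen_exists_readout _ n H ε).measurableSet
  refine isClosed_le (Continuous.norm (Continuous.sub ?_ continuous_const)) continuous_const
  exact (continuous_finsetSum _ fun i _ =>
    (continuous_decodedFeature _).comp (continuous_apply i)).const_smul c

theorem hidden_apply (ω : Weights n m d) (x : workingCube (Fin m × Fin d)) (i : Fin n) :
    hidden ω x i = feature (workingCube (Fin m × Fin d)) (ω i) x := rfl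

theorem autoencoder_error_le {c η : ℝ} {ω : Weights n m d}
    (h : ‖c • ∑ i, decodedFeature (workingCube (Fin m × Fin d)) (ω i) - inclusion _‖ ≤ η)
    (x : Fin m × Fin d → ℝ) (hx : ∀ p, |x p| ≤ 2) (p : Fin m × Fin d) :
    |(c • (ω.matᵀ *ᵥ hidden ω x)) p - x p| ≤ η := by
  have hmem : x ∈ workingCube (Fin m × Fin d) :=
    mem_closedBall_zero_iff.2 ((pi_norm_le_iff_of_nonneg (by norm_num)).2 hx)
  have h1 := (norm_le_pi_norm _ p).trans ((ContinuousMap.norm_coe_le_norm _ ⟨x, hmem⟩).trans h)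
  rw [Real.norm_eq_abs] at h1
  have heq : (c • (ω.matᵀ *ᵥ hidden ω x)) p =
      (c • ∑ i, decodedFeature (workingCube (Fin m × Fin d)) (ω i)) ⟨x, hmem⟩ p := by
    simp only [ContinuousMap.smul_apply, ContinuousMap.sum_apply, Pi.smul_apply,
      Finset.sum_apply, mulVec, dotProduct]
    exact congrArg _ (Finset.sum_congr rfl fun i _ => mul_comm _ _)
  rw [heq]
  exact h1

theorem readout_error_lt {ε : ℝ} {ω : Weights n m d} {a : Fin n → ℝ}
    {H : C(workingCube (Fin m × Fin d), ℝ)}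
    (h : ‖H - ∑ i, a i • feature (workingCube (Fin m × Fin d)) (ω i)‖ < ε)
    (x : workingCube (Fin m × Fin d)) : |H x - a ⬝ᵥ hidden ω x| < ε := by
  have h1 := (ContinuousMap.norm_coe_le_norm _ x).trans_lt h
  simpa only [ContinuousMap.sub_apply, ContinuousMap.sum_apply, ContinuousMap.smul_apply,
    smul_eq_mul, Real.norm_eq_abs, ← hidden_apply, dotProduct] using h1

theorem exists_goodWeights_large (μ : Measure ℝ) [IsProbabilityMeasure μ]
    (hsymm : μ.map (fun x : ℝ => -x) = μ) {r : ℝ} (hr : 0 < r)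
    (hsupp : Set.Icc (-r) r ⊆ μ.support) {M₂ : ℝ} (hint : Integrable (fun x : ℝ => x ^ 2) μ)
    (hM₂ : ∫ x : ℝ, x ^ 2 ∂μ = M₂) (H : C(workingCube (Fin m × Fin d), ℝ))
    {η ε δ : ℝ} (hη : 0 < η) (hε : 0 < ε) (hδ : 0 < δ) :
    ∃ n : ℕ, 0 < n ∧ ENNReal.ofReal (1 - δ) ≤
      weightLaw μ n m d (goodWeights (2 / ((n : ℝ) * M₂)) η ε H) := by
  have hpos : 0 < M₂ := hM₂ ▸ second_moment_pos μ hr hsupp hint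
  refine exists_le_pi_of_ae_eventually (neuronLaw μ (Fin m × Fin d))
    (fun n => goodWeights (n := n) (2 / ((n : ℝ) * M₂)) η ε H)
    (fun n => measurableSet_goodWeights _ η ε H) ?_ hδ
  filter_upwards [ae_eventually_autoencoder μ (ι := Fin m × Fin d) hsymm hint hM₂ hpos hη,
    ae_eventually_exists_readout (workingCube (Fin m × Fin d)) (neuronLaw μ (Fin m × Fin d)) hr
      (mem_support_neuronLaw μ hsupp) H hε] with ω h1 h2
  exact h1.and h2

end GoodSamples

end EchoState

end

/-! ### Assembly -/

theorem mainTheorem2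
    (μ : MeasureTheory.Measure ℝ) [MeasureTheory.IsProbabilityMeasure μ]
    (hsymm : μ.map (fun x : ℝ => -x) = μ)
    (r : ℝ) (hr : 0 < r) (hsupp : Set.Icc (-r) r ⊆ μ.support)
    (M₂ : ℝ) (hint : MeasureTheory.Integrable (fun x : ℝ => x ^ 2) μ)
    (hM₂ : ∫ x : ℝ, x ^ 2 ∂μ = M₂)
    (d : ℕ) (hd : 0 < d)
    (F : (ℤ → EchoState.Cube d) → (ℤ → ℝ))
    (hF : EchoState.IsContinuousCausalTimeInvariant F)
    (ε δ : ℝ) (hε : ε ∈ Set.Ioo (0 : ℝ) 1) (hδ : δ ∈ Set.Ioo (0 : ℝ) 1) :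
    ∃ n m : ℕ, 0 < n ∧ 0 < m ∧
      ∃ E : Set (EchoState.Weights n m d), MeasurableSet E ∧
        ENNReal.ofReal (1 - δ) ≤ EchoState.weightLaw μ n m d E ∧
        ∀ ω ∈ E,
          EchoState.HasSolutions EchoState.relu
            (EchoState.reservoirMatrix (2 / ((n : ℝ) * M₂)) ω) (EchoState.inputWeights ω) ω.bias ∧
          ∃ (a : Fin n → ℝ) (F_ESN : (ℤ → EchoState.Cube d) → (ℤ → ℝ)),
            EchoState.IsESNOperator EchoState.relu
              (EchoState.reservoirMatrix (2 / ((n : ℝ) * M₂)) ω) (EchoState.inputWeights ω) ω.bias a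
              F_ESN ∧
            ∀ (u : ℤ → EchoState.Cube d) (t : ℤ), |F u t - F_ESN u t| ≤ ε := by
  have hε3 : 0 < ε / 3 := by linarith [hε.1]
  obtain ⟨m, H, hm, hH, hmem⟩ :=
    EchoState.exists_finite_memory hF.causal hF.continuous hε3
  let HK : C(EchoState.workingCube (Fin m × Fin d), ℝ) := ⟨fun x => H x, by fun_prop⟩
  obtain ⟨θ, hθ, hHθ⟩ := Metric.uniformContinuous_iff.1
    (CompactSpace.uniformContinuous_of_continuous HK.continuous) (ε / 3) hε3
  have hm' : (0 : ℝ) < m := by exact_mod_cast hm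
  -- The accumulated error `m * η` must be at most `1`, to stay in `[-2,2]^{md}`, and below the
  -- modulus of continuity `θ` of `H`.
  set η : ℝ := min 1 (θ / 2) / m
  have hη : 0 < η := by positivity
  have hmη : m * η = min 1 (θ / 2) := by simp only [η]; field_simp
  obtain ⟨n, hn, hlaw⟩ := EchoState.exists_goodWeights_large μ hsymm hr hsupp hint hM₂ HK hη hε3 hδ.1
  refine ⟨n, m, hn, hm, _, EchoState.measurableSet_goodWeights _ η (ε / 3) HK, hlaw, ?_⟩
  rintro ω ⟨hauto, a, ha⟩
  have hsol := EchoState.exists_solution_near_delayVector (2 / ((n : ℝ) * M₂)) η hη.le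
    (hmη.trans_le (min_le_left _ _)) ω (EchoState.autoencoder_error_le hauto)
  obtain ⟨h1, h2⟩ := EchoState.exists_esn_operator hF.timeInvariant (a := a) (ε := ε) fun u => by
    obtain ⟨s, hs, x, hsx, hx⟩ := hsol u
    refine ⟨s, hs, ?_⟩
    rintro v rfl
    set y := EchoState.delayVector m (EchoState.restrictNonpos v) 0
    have hy1 : ∀ p, |y p| ≤ 1 := EchoState.abs_delayVector_le _ 0
    have hy : y ∈ EchoState.workingCube (Fin m × Fin d) :=
      mem_closedBall_zero_iff.2 ((pi_norm_le_iff_of_nonneg (by norm_num)).2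
        fun p => (hy1 p).trans (by norm_num))
    have hxK : x ∈ EchoState.workingCube (Fin m × Fin d) := by
      refine mem_closedBall_zero_iff.2 ((pi_norm_le_iff_of_nonneg (by norm_num)).2 fun p => ?_)
      have h3 := (hx p).trans (hmη.trans_le (min_le_left _ _))
      have h4 := abs_sub_abs_le_abs_sub (x p) (y p)
      rw [Real.norm_eq_abs]
      linarith [hy1 p]
    have hdist : dist (⟨y, hy⟩ : EchoState.workingCube (Fin m × Fin d)) ⟨x, hxK⟩ < θ := by
      have h3 : dist y x ≤ θ / 2 := by
        refine (dist_pi_le_iff (by positivity)).2 fun p => ?_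
        rw [dist_comm, Real.dist_eq]
        exact (hx p).trans (hmη.trans_le (min_le_right _ _))
      exact lt_of_le_of_lt h3 (by linarith)
    -- The three thirds of `ε`: truncated memory, drift of the reservoir from the delay vector,
    -- readout error.
    have e1 := hmem v
    have e2 : |H y - H x| < ε / 3 := hHθ hdist
    have e3 : |H x - dotProduct a (EchoState.hidden ω x)| < ε / 3 :=
      EchoState.readout_error_lt ha ⟨x, hxK⟩
    rw [hsx]
    have t1 := abs_sub_le (F v 0) (H y) (H x)
    have t2 := abs_sub_le (F v 0) (H x) (dotProduct a (EchoState.hidden ω x))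
    linarith
  exact ⟨h1, a, h2⟩
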